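/- Let $G$ be the interference graph on a finite set of $n$ links, let $\mathcal M\subset\{0,1\}^n$ be the set of incidence vectors of its independent sets, and let $a\in\mathbb R^n$ be a rate vector. *The linear program.* Let $\sigma^{(1)},\dots,\sigma^{(n+1)}\in\mathcal M$ be the columns of the current basis matrix together with the new column $\sigma_{\rm new}$. MOV is the linear program: minimize $\gamma$ over $(x,\gamma)$ subject to $\sum_c x_c\sigma^{(c)}=(1-\gamma)a$, $\sum_c x_c=1$, $x\succeq 0$, $0\le\gamma\le 1$. Let $(x^\star,\gamma^\star)$ be an optimal solution with $\gamma^\star>0$, and let $\theta^\star$ be an optimal dual variable for the rate constraint, i.e. a maximizer over $\theta\in\mathbb R^n$ of $$\min_{x\succeq0,\ \mathbf 1^Tx=1,\ 0\le\gamma\le1}\Big[\gamma+\theta^T\Big((1-\gamma)a-\sum_c x_c\sigma^{(c)}\Big)\Big].$$ Let $B$ be the updated basis matrix: an invertible $n\times n$ matrix whose columns are $n$ of the $n+1$ columns $\sigma^{(c)}$, and suppose that it is nondegenerate, i.e. $x^\star_c>0$ for each of its columns. *The algorithm.* One slot of CSMA$(\theta)$ draws an independent set $D$ from a fixed distribution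 $q$ on independent sets, independently across slots; each link $i\in D$ with no neighbour in the previous schedule $\sigma_{\rm csma}(t-1)$ becomes active with probability $e^{\theta_i}/(1+e^{\theta_i})$ and inactive otherwise, independently over links, and every other link keeps its state. Every link is assumed to lie in $D$ with positive probability. Slot $t\ge1$ runs CSMA$(\alpha\theta(t))$, where the (deterministic) parameters satisfy $\theta(t)\to\theta^\star$ as $t\to\infty$ (for example $\theta(t)=\theta^\star$ for all $t$), and the initial state $\sigma_{\rm csma}(0)$ is an independent set. *Claim.* For every $\delta>0$ there is $\alpha_0$, depending only on $\delta$ and the data of the first two paragraphs, such that for every $\alpha\ge\alpha_0$, every such $q$ and every such sequence $\theta(t)$ there is a time $T$ such that for all $t\ge T$ and every initial independent set, $$\Pr\Big(\sigma_{\rm csma}(t)\in\arg\max_{\sigma\in\mathcal M}\mathbf 1^TB^{-1}\sigma\Big)\ \ge\ 1-\delta .$$ -/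

import Mathlib

open scoped Matrix

namespace SimplexCSMA

noncomputable section

/-! Independent sets, their 0/1 vectors, and maximum-weight independent sets. -/

/-- The 0/1 incidence vector in `ℝ^V` of a set `S` of links. -/
def indVec {V : Type*} [DecidableEq V] (S : Finset V) : V → ℝ :=
  fun i => if i ∈ S then 1 else 0

/-- `S` belongs to the argmax of `w ⬝ σ` over all independent sets `σ` of `G`. -/
def IsMaxWeightIndepSet {V : Type*} [Fintype V] [DecidableEq V] (G : SimpleGraph V)
    (w : V → ℝ) (S : Finset V) : Prop :=
  G.IsIndepSet (S : Set V) ∧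
    ∀ S' : Finset V, G.IsIndepSet (S' : Set V) → w ⬝ᵥ indVec S' ≤ w ⬝ᵥ indVec S

/-! The linear program MOV over `n + 1` candidate sets `C`, and its Lagrangian dual.
The sets `C (some k)` are the columns of the current matrix and `C none` is the new set;
a point is a pair `z = (x, γ)`. -/

/-- The simple constraints: `x` lies in the simplex and `0 ≤ γ ≤ 1`. -/
def movDomain (V : Type*) [Fintype V] : Set ((Option V → ℝ) × ℝ) :=
  {z | (∀ c, 0 ≤ z.1 c) ∧ ∑ c, z.1 c = 1 ∧ 0 ≤ z.2 ∧ z.2 ≤ 1}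

/-- The residual `(1 - γ) a - ∑ x_σ σ` of the rate constraint. -/
def movResidual {V : Type*} [Fintype V] [DecidableEq V] (C : Option V → Finset V) (a : V → ℝ)
    (z : (Option V → ℝ) × ℝ) : V → ℝ :=
  (1 - z.2) • a - ∑ c, z.1 c • indVec (C c)

/-- `z = (x, γ)` is an optimal solution of MOV: minimize `γ` subject to the simple constraints
and the rate constraint `∑ x_σ σ = (1 - γ) a`. -/
def IsMovOptimal {V : Type*} [Fintype V] [DecidableEq V] (C : Option V → Finset V) (a : V → ℝ)
    (z : (Option V → ℝ) × ℝ) : Prop :=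
  z ∈ movDomain V ∧ movResidual C a z = 0 ∧
    ∀ z' ∈ movDomain V, movResidual C a z' = 0 → z.2 ≤ z'.2

/-- The Lagrangian of MOV, with multiplier `θ` for the rate constraint. -/
def movLagrangian {V : Type*} [Fintype V] [DecidableEq V] (C : Option V → Finset V) (a : V → ℝ)
    (θ : V → ℝ) (z : (Option V → ℝ) × ℝ) : ℝ :=
  z.2 + θ ⬝ᵥ movResidual C a z

/-- The dual function of MOV. The infimum is over a nonempty compact set, so it is attained. -/
def movDual {V : Type*} [Fintype V] [DecidableEq V] (C : Option V → Finset V) (a : V → ℝ)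
    (θ : V → ℝ) : ℝ :=
  sInf (movLagrangian C a θ '' movDomain V)

/-- `θ` is an optimal dual variable of MOV. -/
def IsMovDualOptimal {V : Type*} [Fintype V] [DecidableEq V] (C : Option V → Finset V)
    (a : V → ℝ) (θ : V → ℝ) : Prop :=
  ∀ θ' : V → ℝ, movDual C a θ' ≤ movDual C a θ

/-- The square matrix whose columns are the incidence vectors of the sets `C (e k)`. -/
def basisMatrix {V : Type*} [DecidableEq V] (C : Option V → Finset V) (e : V → Option V) :
    Matrix V V ℝ :=
  Matrix.of fun i k => indVec (C (e k)) i

/-! The random schedule generated by CSMA. -/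

/-- The access probability `exp θ / (1 + exp θ)`. -/
def accessProb (θ : ℝ) : unitInterval :=
  ⟨Real.exp θ / (1 + Real.exp θ), by positivity, by
    rw [div_le_one (by positivity)]
    linarith⟩

/-- Independent coins, the coin of link `i` showing `true` with probability
`exp (θ i) / (1 + exp (θ i))`. -/
def csmaCoins {V : Type*} [Fintype V] (θ : V → ℝ) : PMF (V → Bool) :=
  (MeasureTheory.Measure.pi fun i =>
    ProbabilityTheory.bernoulliMeasure true false (accessProb (θ i))).toPMF

open Classical in
/-- One slot, with decision set `D`, coins `ξ` and previous schedule `S`: a link of `D` none of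
whose neighbours is in `S` becomes active iff its coin shows `true`; every other link keeps its
state. -/
def csmaUpdate {V : Type*} [Fintype V] (G : SimpleGraph V) (D : Finset V) (ξ : V → Bool)
    (S : Finset V) : Finset V :=
  Finset.univ.filter fun i =>
    if i ∈ D ∧ ∀ j ∈ S, ¬ G.Adj i j then ξ i = true else i ∈ S

/-- The law of the next schedule of CSMA(`θ`) given the previous schedule `S`, when the decision
set is drawn from `q` (independently of the coins). -/
def csmaStep {V : Type*} [Fintype V] (G : SimpleGraph V) (q : PMF (Finset V)) (θ : V → ℝ)
    (S : Finset V) : PMF (Finset V) :=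
  q.bind fun D => (csmaCoins θ).map fun ξ => csmaUpdate G D ξ S

/-- The law of the schedule at time `t`, started from `S₀` at time `0`, when slot `t ≥ 1` runs
CSMA(`θ t`), with independent randomness in different slots. -/
def csmaLaw {V : Type*} [Fintype V] (G : SimpleGraph V) (q : PMF (Finset V)) (θ : ℕ → V → ℝ)
    (S₀ : Finset V) : ℕ → PMF (Finset V)
  | 0 => PMF.pure S₀
  | t + 1 => (csmaLaw G q θ S₀ t).bind (csmaStep G q (θ (t + 1)))

end

end SimplexCSMA

namespace SimplexCSMA

noncomputable section

/-! ### Optimality conditions of MOV -/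

section MOV

variable {V : Type*} [Fintype V] [DecidableEq V] {C : Option V → Finset V} {a : V → ℝ}

/-! The two halves are linear programming and simulated annealing. Write `u` for the price vector
`1ᵀB⁻¹`, which gives every basis column price one.

Perturbing the optimal point along directions that keep both equality constraints shows that no
column has price above one and that `(1 - γ) * (u ⬝ᵥ a) = 1` (`IsMovOptimal.reducedCosts`). Hence
`(1 - γ) • u` has dual value at least `γ`, and so has any optimal dual variable `θ`. Complementary
slackness then forces `θ` to give each basis column price `1 - γ`; as `B` is invertible, `θ = (1 -
γ) • u` (`IsMovDualOptimal.eq_smul`). Since `1 - γ > 0`, both vectors have the same maximizing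
independent sets.

For fixed parameters, CSMA preserves the Gibbs weights `exp (θ ⬝ σ)`
(`sum_gibbsWeight_mul_transfer`) and can empty any schedule in a bounded number of slots
(`exists_minorization`), so Doeblin's contraction gives convergence to the Gibbs law. Only a fixed
number of final slots matters, so convergent parameters do no harm
(`eventually_le_expect_chainLaw`). For large `α` the Gibbs law concentrates on the maximizers
(`eventually_gibbsWeight_concentrated`). -/

lemma dotProduct_movResidual (θ : V → ℝ) (z : (Option V → ℝ) × ℝ) :
    θ ⬝ᵥ movResidual C a z = (1 - z.2) * (θ ⬝ᵥ a) - ∑ c, z.1 c * (θ ⬝ᵥ indVec (C c)) := by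
  simp [movResidual, dotProduct_sub, dotProduct_sum, dotProduct_smul]

/-- The cost does not decrease along a feasible direction. -/
lemma IsMovOptimal.nonneg_of_direction {x : Option V → ℝ} {γ : ℝ}
    (hopt : IsMovOptimal C a (x, γ)) (hγ : 0 < γ) {ξ : Option V → ℝ} {ρ : ℝ}
    (hsum : ∑ c, ξ c = 0) (hres : ∑ c, ξ c • indVec (C c) = -(ρ • a))
    (hξ : ∀ c, 0 < x c ∨ 0 ≤ ξ c) : 0 ≤ ρ := by
  by_contra! hρ
  obtain ⟨⟨hx0, hx1, -, hγ1⟩, hr, hmin⟩ := hopt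
  simp only at hx0 hx1 hγ1
  have hcont : ∀ r b : ℝ, 0 < r → ∀ᶠ t in nhdsWithin (0 : ℝ) (Set.Ioi 0), 0 ≤ r + t * b := by
    intro r b hr
    have : Filter.Tendsto (fun t : ℝ => r + t * b) (nhdsWithin 0 (Set.Ioi 0)) (nhds r) := by
      have h : Continuous fun t : ℝ => r + t * b := by fun_prop
      simpa using (h.tendsto 0).mono_left nhdsWithin_le_nhds
    exact (this.eventually (lt_mem_nhds hr)).mono fun _ => le_of_lt
  have hev : ∀ᶠ t in nhdsWithin (0 : ℝ) (Set.Ioi 0), ∀ c, 0 ≤ x c + t * ξ c := by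
    rw [Filter.eventually_all]
    intro c
    rcases hξ c with h | h
    · exact hcont _ _ h
    · filter_upwards [self_mem_nhdsWithin] with t ht
      exact add_nonneg (hx0 c) (mul_nonneg (le_of_lt ht) h)
  -- A small step along the direction stays feasible: `0 < γ` keeps the cost nonnegative, and `ρ <
  -- 0` keeps it at most one while making it smaller than the optimum.
  obtain ⟨t, ht, h1, h2⟩ :=
    (hev.and ((hcont γ ρ hγ).and self_mem_nhdsWithin)).exists
  have ht0 : 0 < t := h2
  have htρ : t * ρ < 0 := mul_neg_of_pos_of_neg ht0 hρ
  have := hmin (fun c => x c + t * ξ c, γ + t * ρ) ⟨ht, by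
      simp [Finset.sum_add_distrib, ← Finset.mul_sum, hsum, hx1], h1, by
      simp only; linarith⟩ (by
      have e1 : movResidual C a (fun c => x c + t * ξ c, γ + t * ρ)
          = movResidual C a (x, γ) - t • (ρ • a + ∑ c, ξ c • indVec (C c)) := by
        simp only [movResidual, add_smul, Finset.sum_add_distrib, mul_smul, ← Finset.smul_sum,
          sub_smul, smul_add]
        abel
      rw [e1, hr, hres]
      simp)
  simp only at this
  linarith

/-! ### Basis prices and reduced costs. -/

variable {e : V → Option V}

lemma basisMatrix_mulVec (y : V → ℝ) :
    basisMatrix C e *ᵥ y = ∑ k, y k • indVec (C (e k)) := by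
  ext i
  simp [Matrix.mulVec, dotProduct, basisMatrix, mul_comm]

lemma vecMul_basisMatrix (θ : V → ℝ) (k : V) :
    (θ ᵥ* basisMatrix C e) k = θ ⬝ᵥ indVec (C (e k)) := by
  simp [Matrix.vecMul, dotProduct, basisMatrix]

lemma one_vecMul_inv_dotProduct (hB : IsUnit (basisMatrix C e)) (k : V) :
    ((1 : V → ℝ) ᵥ* (basisMatrix C e)⁻¹) ⬝ᵥ indVec (C (e k)) = 1 := by
  rw [← vecMul_basisMatrix (e := e), Matrix.vecMul_vecMul,
    Matrix.nonsing_inv_mul _ ((Matrix.isUnit_iff_isUnit_det _).1 hB)]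
  simp

/-- An injection of the basis columns into all columns misses exactly one column. -/
lemma exists_equiv_extending (he : Function.Injective e) :
    ∃ E : Option V ≃ Option V, ∀ k, E (some k) = e k := by
  have hne : ∃ c, c ∉ Set.range e := by
    by_contra! h
    have h1 := Fintype.card_le_of_surjective e h
    simp at h1
  obtain ⟨c, hc⟩ := hne
  have hinj : Function.Injective (fun o : Option V => o.elim c e) := by
    rintro (_ | i) (_ | j) h
    · rfl
    · exact (hc ⟨j, h.symm⟩).elim
    · exact (hc ⟨i, h⟩).elim
    · exact congrArg some (he h)
  exact ⟨Equiv.ofBijective _ (Finite.injective_iff_bijective.1 hinj), fun k => rfl⟩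

/-- Primal optimality at a nondegenerate basis: the reduced costs have the right sign. -/
lemma IsMovOptimal.reducedCosts {x : Option V → ℝ} {γ : ℝ}
    (hopt : IsMovOptimal C a (x, γ)) (hγ : 0 < γ) (he : Function.Injective e)
    (hB : IsUnit (basisMatrix C e)) (hpos : ∀ k, 0 < x (e k)) :
    (1 - γ) * (((1 : V → ℝ) ᵥ* (basisMatrix C e)⁻¹) ⬝ᵥ a) = 1 ∧
      ∀ c, ((1 : V → ℝ) ᵥ* (basisMatrix C e)⁻¹) ⬝ᵥ indVec (C c) ≤ 1 := by
  set B := basisMatrix C e with hBdef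
  set u := (1 : V → ℝ) ᵥ* B⁻¹ with hu
  have hub : ∀ k, u ⬝ᵥ indVec (C (e k)) = 1 := one_vecMul_inv_dotProduct hB
  obtain ⟨E, hE⟩ := exists_equiv_extending he
  set d := indVec (C (E none)) with hd
  have hx1 : ∑ c, x c = 1 := hopt.1.2.1
  have hbal : (1 - γ) * (u ⬝ᵥ a) = 1 + x (E none) * (u ⬝ᵥ d - 1) := by
    have h := dotProduct_movResidual (C := C) (a := a) u (x, γ)
    rw [hopt.2.1, dotProduct_zero, ← E.sum_comp, Fintype.sum_option] at h
    rw [← E.sum_comp, Fintype.sum_option] at hx1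
    simp only [hE, hub, mul_one] at h hx1
    simp only [hd]
    linarith
  -- Move the weight of the non-basic column at rate `s` and the cost at rate `ρ`; the basic weights
  -- must then move at rate `y` to keep the rate constraint. The hypothesis on `s` and `ρ` says
  -- exactly that the total weight is unchanged. Nondegeneracy lets the basic weights move either
  -- way.
  have hdir : ∀ s ρ : ℝ, s * (1 - u ⬝ᵥ d) = ρ * (u ⬝ᵥ a) → (0 < x (E none) ∨ 0 ≤ s) →
      0 ≤ ρ := by
    intro s ρ hs hxs
    set y : V → ℝ := B⁻¹ *ᵥ (-(ρ • a) - s • d) with hy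
    have hBy : B *ᵥ y = -(ρ • a) - s • d := by
      rw [hy, Matrix.mulVec_mulVec, Matrix.mul_nonsing_inv _
        ((Matrix.isUnit_iff_isUnit_det _).1 hB), Matrix.one_mulVec]
    have hsumy : ∑ k, y k = -(ρ * (u ⬝ᵥ a)) - s * (u ⬝ᵥ d) := by
      have : (1 : V → ℝ) ⬝ᵥ y = ∑ k, y k := by simp [dotProduct]
      rw [← this, hy, Matrix.dotProduct_mulVec, ← hu]
      simp [dotProduct_sub]
    refine hopt.nonneg_of_direction hγ (ξ := fun c => (E.symm c).elim s y) ?_ ?_ ?_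
    · rw [← E.sum_comp, Fintype.sum_option]
      simp only [Equiv.symm_apply_apply, Option.elim_none, Option.elim_some]
      rw [hsumy]
      linarith
    · rw [← E.sum_comp, Fintype.sum_option]
      simp only [Equiv.symm_apply_apply, Option.elim_none, Option.elim_some]
      simp only [hE]
      rw [← basisMatrix_mulVec, ← hBdef, hBy]
      simp [hd]
    · intro c
      obtain ⟨o, rfl⟩ := E.surjective c
      rcases o with _ | k
      · simpa using hxs
      · left
        rw [hE]
        exact hpos k
  have key : (1 - γ) * (u ⬝ᵥ a) = 1 ∧ u ⬝ᵥ d ≤ 1 := by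
    -- With positive non-basic weight both signs of the direction are allowed, so the reduced cost
    -- vanishes. With zero weight the column may only enter, which gives an inequality; dividing by
    -- `u ⬝ᵥ a` is legitimate because `hbal` makes it positive.
    rcases (hopt.1.1 (E none)).lt_or_eq with h | h
    · have h1 := hdir (u ⬝ᵥ a) (1 - u ⬝ᵥ d) (by ring) (Or.inl h)
      have h2 := hdir (-(u ⬝ᵥ a)) (-(1 - u ⬝ᵥ d)) (by ring) (Or.inl h)
      have h3 : u ⬝ᵥ d = 1 := by linarith
      exact ⟨by rw [hbal, h3]; ring, h3.le⟩
    · simp only at h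
      rw [← h] at hbal
      have h1 : (1 - γ) * (u ⬝ᵥ a) = 1 := by linarith
      have h2 : 0 ≤ 1 - γ := sub_nonneg.2 hopt.1.2.2.2
      have h3 : 0 < u ⬝ᵥ a := by
        by_contra! h4
        nlinarith [mul_nonpos_of_nonneg_of_nonpos h2 h4]
      have h5 := hdir 1 ((1 - u ⬝ᵥ d) / (u ⬝ᵥ a)) (by field_simp) (Or.inr zero_le_one)
      have h6 : 0 ≤ 1 - u ⬝ᵥ d := by
        rw [div_nonneg_iff] at h5
        rcases h5 with h5 | h5
        · exact h5.1
        · linarith [h5.2]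
      exact ⟨h1, by linarith⟩
  refine ⟨key.1, fun c => ?_⟩
  obtain ⟨o, rfl⟩ := E.surjective c
  rcases o with _ | k
  · exact key.2
  · rw [hE, hub]

/-! ### Lagrangian duality for MOV. -/

/-- The dual function bounds the Lagrangian from below. -/
lemma movDual_le_movLagrangian (θ : V → ℝ) {z : (Option V → ℝ) × ℝ} (hz : z ∈ movDomain V) :
    movDual C a θ ≤ movLagrangian C a θ z := by
  refine csInf_le ⟨-|θ ⬝ᵥ a| - ∑ c, |θ ⬝ᵥ indVec (C c)|, ?_⟩ ⟨z, hz, rfl⟩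
  rintro _ ⟨z, ⟨h0, h1, h2, h3⟩, rfl⟩
  rw [movLagrangian, dotProduct_movResidual]
  have hx : ∀ c, z.1 c ≤ 1 := fun c => by
    rw [← h1]
    exact Finset.single_le_sum (fun c _ => h0 c) (Finset.mem_univ c)
  have hs : ∑ c, z.1 c * (θ ⬝ᵥ indVec (C c)) ≤ ∑ c, |θ ⬝ᵥ indVec (C c)| := by
    refine Finset.sum_le_sum fun c _ => ?_
    calc z.1 c * (θ ⬝ᵥ indVec (C c)) ≤ z.1 c * |θ ⬝ᵥ indVec (C c)| :=
          mul_le_mul_of_nonneg_left (le_abs_self _) (h0 c)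
      _ ≤ 1 * |θ ⬝ᵥ indVec (C c)| := mul_le_mul_of_nonneg_right (hx c) (abs_nonneg _)
      _ = _ := one_mul _
  have ha : -|θ ⬝ᵥ a| ≤ (1 - z.2) * (θ ⬝ᵥ a) := by
    have h4 : |(1 - z.2) * (θ ⬝ᵥ a)| ≤ |θ ⬝ᵥ a| := by
      rw [abs_mul]
      refine mul_le_of_le_one_left (abs_nonneg _) ?_
      rw [abs_le]
      constructor <;> linarith
    exact (neg_le_neg h4).trans (neg_abs_le _)
  linarith

/-- An optimal dual variable of MOV is a positive multiple of the prices of the basis. -/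
lemma IsMovDualOptimal.eq_smul {x : Option V → ℝ} {γ : ℝ}
    (hopt : IsMovOptimal C a (x, γ)) (hγ : 0 < γ) (he : Function.Injective e)
    (hB : IsUnit (basisMatrix C e)) (hpos : ∀ k, 0 < x (e k)) {θ : V → ℝ}
    (hθ : IsMovDualOptimal C a θ) :
    γ < 1 ∧ θ = (1 - γ) • ((1 : V → ℝ) ᵥ* (basisMatrix C e)⁻¹) := by
  obtain ⟨hua, huc⟩ := hopt.reducedCosts hγ he hB hpos
  set u := (1 : V → ℝ) ᵥ* (basisMatrix C e)⁻¹ with hu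
  have hγ1 : γ < 1 := by
    refine lt_of_le_of_ne hopt.1.2.2.2 ?_
    rintro rfl
    simp at hua
  refine ⟨hγ1, ?_⟩
  -- At `(1 - γ) • u` the value `(1 - γ) * (u ⬝ᵥ a) = 1` cancels `γ` from the Lagrangian, leaving
  -- one minus an average of column prices that are at most `1 - γ`.
  have hg : γ ≤ movDual C a ((1 - γ) • u) := by
    refine le_csInf (Set.Nonempty.image _ ⟨_, hopt.1⟩) ?_
    rintro _ ⟨z, ⟨h0, h1, h2, h3⟩, rfl⟩
    rw [movLagrangian, dotProduct_movResidual]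
    simp only [smul_dotProduct, smul_eq_mul, hua]
    have hs : ∑ c, z.1 c * ((1 - γ) * (u ⬝ᵥ indVec (C c))) ≤ ∑ c, z.1 c * (1 - γ) := by
      refine Finset.sum_le_sum fun c _ => mul_le_mul_of_nonneg_left ?_ (h0 c)
      exact mul_le_of_le_one_right (by linarith) (huc c)
    rw [← Finset.sum_mul, h1] at hs
    linarith
  have hL : ∀ z ∈ movDomain V, γ ≤ movLagrangian C a θ z := fun z hz =>
    (hg.trans (hθ _)).trans (movDual_le_movLagrangian θ hz)
  set s : Option V → ℝ := fun c => θ ⬝ᵥ indVec (C c) with hs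
  -- The Lagrangian is tested at the vertices of the simplex; `γ' = 1` and `γ' = 0` give two bounds
  -- on the price of each column.
  have hvertex : ∀ c γ', 0 ≤ γ' → γ' ≤ 1 → γ ≤ γ' + ((1 - γ') * (θ ⬝ᵥ a) - s c) := by
    intro c γ' h0 h1
    have h := hL (Pi.single c 1, γ') ⟨fun c' => by
      by_cases h : c' = c
      · subst h; simp
      · simp [h], by simp, h0, h1⟩
    rw [movLagrangian, dotProduct_movResidual] at h
    simpa [Pi.single_apply] using h
  have hs1 : ∀ c, s c ≤ 1 - γ := fun c => by
    have := hvertex c 1 zero_le_one le_rfl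
    linarith
  have hs2 : ∀ c, s c ≤ θ ⬝ᵥ a - γ := fun c => by
    have := hvertex c 0 le_rfl zero_le_one
    linarith
  have hbal : (1 - γ) * (θ ⬝ᵥ a) = ∑ c, x c * s c := by
    have h := dotProduct_movResidual (C := C) (a := a) θ (x, γ)
    rw [hopt.2.1, dotProduct_zero] at h
    simp only at h
    linarith
  have havg : ∀ b, (∀ c, s c ≤ b) → ∑ c, x c * s c ≤ b := fun b hb => by
    calc ∑ c, x c * s c ≤ ∑ c, x c * b :=
          Finset.sum_le_sum fun c _ => mul_le_mul_of_nonneg_left (hb c) (hopt.1.1 c)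
      _ = b := by rw [← Finset.sum_mul, hopt.1.2.1, one_mul]
  -- Averaging the two bounds over `x` yields the two inequalities, after cancelling `1 - γ` and `γ`
  -- respectively.
  have hA : θ ⬝ᵥ a = 1 := by
    have h1 := havg _ hs1
    have h2 := havg _ hs2
    rw [← hbal] at h1 h2
    refine le_antisymm ?_ ?_
    · exact le_of_mul_le_mul_left (by linarith) (sub_pos.2 hγ1)
    · exact le_of_mul_le_mul_left (by linarith) hγ
  -- Complementary slackness: a vanishing sum of nonnegative terms, so columns of positive weight
  -- have price exactly `1 - γ`.
  have hzero : ∑ c, x c * ((1 - γ) - s c) = 0 := by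
    rw [Finset.sum_congr rfl fun c _ => mul_sub (x c) (1 - γ) (s c), Finset.sum_sub_distrib,
      ← hbal, ← Finset.sum_mul, hopt.1.2.1, hA]
    ring
  have hterm := (Finset.sum_eq_zero_iff_of_nonneg fun c _ =>
    mul_nonneg (hopt.1.1 c) (sub_nonneg.2 (hs1 c))).1 hzero
  have hθB : θ ᵥ* basisMatrix C e = (1 - γ) • (1 : V → ℝ) := by
    ext k
    rw [vecMul_basisMatrix]
    have := (mul_eq_zero.1 (hterm (e k) (Finset.mem_univ _))).resolve_left (hpos k).ne'
    simp only [hs] at this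
    simp
    linarith
  rw [hu, ← Matrix.smul_vecMul, ← hθB, Matrix.vecMul_vecMul, Matrix.mul_nonsing_inv _
    ((Matrix.isUnit_iff_isUnit_det _).1 hB), Matrix.vecMul_one]

lemma isMaxWeightIndepSet_smul_iff {G : SimpleGraph V} {r : ℝ} (hr : 0 < r) (w : V → ℝ)
    (S : Finset V) : IsMaxWeightIndepSet G (r • w) S ↔ IsMaxWeightIndepSet G w S := by
  simp only [IsMaxWeightIndepSet, smul_dotProduct, smul_eq_mul, mul_le_mul_iff_right₀ hr]

end MOV

/-! ### Markov chains on a finite set, through their action on functions -/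

section Markov

variable {X : Type*}

/-- The law at time `t` of the time-inhomogeneous chain whose step into time `t` is `K t`. -/
def chainLaw (K : ℕ → X → PMF X) (x : X) : ℕ → PMF X
  | 0 => PMF.pure x
  | t + 1 => (chainLaw K x t).bind (K (t + 1))

lemma support_chainLaw_subset {K : ℕ → X → PMF X} {I : Set X}
    (hI : ∀ t, ∀ x ∈ I, (K t x).support ⊆ I) {x : X} (hx : x ∈ I) (t : ℕ) :
    (chainLaw K x t).support ⊆ I := by
  induction t with
  | zero =>
    intro y hy
    simp only [chainLaw, PMF.mem_support_pure_iff] at hy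
    exact hy ▸ hx
  | succ t ih =>
    intro y hy
    simp only [chainLaw, PMF.mem_support_bind_iff] at hy
    obtain ⟨z, hz, hy⟩ := hy
    exact hI _ z (ih hz) hy

variable [Fintype X]

/-- The expectation of a function on a finite set under a probability mass function. -/
def expect (p : PMF X) : (X → ℝ) →ₗ[ℝ] ℝ :=
  ∑ x, (p x).toReal • LinearMap.proj x

lemma expect_apply (p : PMF X) (f : X → ℝ) : expect p f = ∑ x, (p x).toReal * f x := by
  simp [expect]

lemma sum_toReal_eq_one (p : PMF X) : ∑ x, (p x).toReal = 1 := by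
  rw [← ENNReal.toReal_sum fun x _ => p.apply_ne_top x, ← tsum_fintype (L := .unconditional X),
    p.tsum_coe, ENNReal.toReal_one]

lemma expect_const (p : PMF X) (b : ℝ) : expect p (fun _ => b) = b := by
  rw [expect_apply, ← Finset.sum_mul, sum_toReal_eq_one, one_mul]

lemma expect_mono {p : PMF X} {f g : X → ℝ} (h : ∀ x ∈ p.support, f x ≤ g x) :
    expect p f ≤ expect p g := by
  rw [expect_apply, expect_apply]
  refine Finset.sum_le_sum fun x _ => ?_
  by_cases hx : x ∈ p.support
  · exact mul_le_mul_of_nonneg_left (h x hx) ENNReal.toReal_nonneg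
  · simp [(p.apply_eq_zero_iff x).2 hx]

lemma expect_nonneg {p : PMF X} {f : X → ℝ} (h : ∀ x ∈ p.support, 0 ≤ f x) :
    0 ≤ expect p f := by
  simpa [expect_const] using expect_mono (f := fun _ => 0) h

lemma mul_le_expect {p : PMF X} {f : X → ℝ} (h : ∀ x ∈ p.support, 0 ≤ f x) (x : X) :
    (p x).toReal * f x ≤ expect p f := by
  rw [expect_apply]
  refine Finset.single_le_sum (f := fun x => (p x).toReal * f x) (fun y _ => ?_)
    (Finset.mem_univ x)
  by_cases hy : y ∈ p.support
  · exact mul_nonneg ENNReal.toReal_nonneg (h y hy)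
  · simp [(p.apply_eq_zero_iff y).2 hy]

lemma expect_pure (x : X) (f : X → ℝ) : expect (PMF.pure x) f = f x := by
  classical
  rw [expect_apply, Finset.sum_eq_single x] <;> simp +contextual [PMF.pure_apply]

lemma expect_bind {Y : Type*} [Fintype Y] (p : PMF X) (K : X → PMF Y) (f : Y → ℝ) :
    expect (p.bind K) f = expect p fun x => expect (K x) f := by
  have h : ∀ y, ((p.bind K) y).toReal = ∑ x, (p x).toReal * (K x y).toReal := fun y => by
    rw [PMF.bind_apply, tsum_fintype, ENNReal.toReal_sum fun x _ =>
      ENNReal.mul_ne_top (p.apply_ne_top x) ((K x).apply_ne_top y)]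
    simp [ENNReal.toReal_mul]
  simp only [expect_apply, h, Finset.sum_mul, Finset.mul_sum]
  rw [Finset.sum_comm]
  simp only [mul_assoc]

lemma expect_map {Y : Type*} [Fintype Y] (p : PMF X) (g : X → Y) (f : Y → ℝ) :
    expect (p.map g) f = expect p fun x => f (g x) := by
  rw [PMF.map, expect_bind]
  simp [expect_pure]

lemma toReal_toOuterMeasure_eq_expect (p : PMF X) (s : Set X) :
    (p.toOuterMeasure s).toReal = expect p (s.indicator 1) := by
  classical
  rw [PMF.toOuterMeasure_apply_fintype, ENNReal.toReal_sum, expect_apply]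
  · refine Finset.sum_congr rfl fun x _ => ?_
    by_cases hx : x ∈ s <;> simp [hx]
  · intro x _
    by_cases hx : x ∈ s <;> simp [hx, p.apply_ne_top]

/-- The action of a kernel on functions. -/
def transfer (K : X → PMF X) : Module.End ℝ (X → ℝ) :=
  LinearMap.pi fun x => expect (K x)

lemma transfer_apply (K : X → PMF X) (f : X → ℝ) (x : X) : transfer K f x = expect (K x) f :=
  rfl

lemma transfer_pow_const (K : X → PMF X) (n : ℕ) (b : ℝ) :
    (transfer K ^ n) (fun _ => b) = fun _ => b := by
  induction n with
  | zero => rfl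
  | succ n ih =>
    rw [pow_succ', Module.End.mul_apply, ih]
    ext x
    exact expect_const _ _

lemma transfer_pow_nonneg {K : X → PMF X} {I : Set X} (hI : ∀ x ∈ I, (K x).support ⊆ I) (n : ℕ)
    {f : X → ℝ} (hf : ∀ x ∈ I, 0 ≤ f x) : ∀ x ∈ I, 0 ≤ (transfer K ^ n) f x := by
  induction n with
  | zero => exact hf
  | succ n ih =>
    intro x hx
    rw [pow_succ', Module.End.mul_apply]
    exact expect_nonneg fun y hy => ih y (hI x hx hy)

/-! ### Mixing of chains with convergent kernels. -/

/-- Doeblin's contraction: an operator that fixes constants and charges a point uniformly makes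
every function asymptotically constant. -/
lemma exists_pow_le_of_minorized {U : Module.End ℝ (X → ℝ)} {I : Set X} {x₀ : X} (hx₀ : x₀ ∈ I)
    {ε : ℝ} (hε : 0 < ε) (hconst : ∀ b, U (fun _ => b) = fun _ => b)
    (hU : ∀ f : X → ℝ, (∀ x ∈ I, 0 ≤ f x) → ∀ x ∈ I, ε * f x₀ ≤ U f x)
    (f : X → ℝ) {κ : ℝ} (hκ : 0 < κ) :
    ∃ N : ℕ, ∃ b, ∀ x ∈ I, b ≤ (U ^ N) f x ∧ (U ^ N) f x ≤ b + κ := by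
  have hε1 : ε ≤ 1 := by
    have := hU (fun _ => 1) (fun _ _ => zero_le_one) x₀ hx₀
    rwa [hconst, mul_one] at this
  obtain ⟨M, hM⟩ : ∃ M, ∀ x, |f x| ≤ M :=
    ⟨∑ x, |f x|, fun x => Finset.single_le_sum (f := fun x => |f x|)
      (fun y _ => abs_nonneg _) (Finset.mem_univ x)⟩
  have hM0 : 0 ≤ M := (abs_nonneg _).trans (hM x₀)
  have hstep : ∀ N : ℕ, ∃ b, ∀ x ∈ I,
      b ≤ (U ^ N) f x ∧ (U ^ N) f x ≤ b + (1 - ε) ^ N * (2 * M) := by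
    intro N
    induction N with
    | zero =>
      refine ⟨-M, fun x _ => ?_⟩
      have := abs_le.1 (hM x)
      simp only [pow_zero, Module.End.one_apply]
      constructor <;> linarith
    | succ N ih =>
      obtain ⟨b, hb⟩ := ih
      set g := (U ^ N) f with hg
      set r := (1 - ε) ^ N * (2 * M) with hr
      -- Minorizing the nonnegative functions `g - b` and `b + r - g` raises the lower bound by `ε *
      -- (g x₀ - b)` and lowers the upper one by `ε * (b + r - g x₀)`, so the width shrinks by `ε *
      -- r`.
      refine ⟨b + ε * (g x₀ - b), fun x hx => ?_⟩
      rw [pow_succ', Module.End.mul_apply, ← hg]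
      have h1 := hU (g - fun _ => b) (fun y hy => sub_nonneg.2 (hb y hy).1) x hx
      have h2 := hU ((fun _ => b + r) - g) (fun y hy => sub_nonneg.2 (hb y hy).2) x hx
      rw [map_sub, hconst] at h1 h2
      simp only [Pi.sub_apply] at h1 h2
      have h3 : (1 - ε) ^ (N + 1) * (2 * M) = (1 - ε) * r := by rw [hr]; ring
      rw [h3]
      constructor <;> linarith
  have hlim : Filter.Tendsto (fun N : ℕ => (1 - ε) ^ N * (2 * M)) Filter.atTop (nhds 0) := by
    simpa using (tendsto_pow_atTop_nhds_zero_of_lt_one (r := 1 - ε) (by linarith)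
      (by linarith)).mul_const (2 * M)
  obtain ⟨N, hN⟩ := (hlim.eventually (gt_mem_nhds hκ)).exists
  obtain ⟨b, hb⟩ := hstep N
  exact ⟨N, b, fun x hx => ⟨(hb x hx).1, (hb x hx).2.trans (by linarith)⟩⟩

/-- The last `m` kernels are replaced by `L` one at a time, the latest first. Each replacement costs
an error in sup norm, which averaging does not enlarge; this is why the bound is uniform in the
starting point. -/
lemma eventually_expect_chainLaw_add {K : ℕ → X → PMF X} {L : X → PMF X}
    (hK : ∀ f : X → ℝ, Filter.Tendsto (fun t => transfer (K t) f) Filter.atTop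
      (nhds (transfer L f))) (m : ℕ) (f : X → ℝ) {η : ℝ} (hη : 0 < η) :
    ∀ᶠ t in Filter.atTop, ∀ x, expect (chainLaw K x t) ((transfer L ^ m) f) - η ≤
      expect (chainLaw K x (t + m)) f := by
  induction m generalizing f η with
  | zero => exact Filter.Eventually.of_forall fun t x => by simp [hη.le]
  | succ m ih =>
    have h1 : ∀ᶠ t in Filter.atTop, ∀ y, transfer L f y - η / 2 ≤ transfer (K t) f y := by
      rw [Filter.eventually_all]
      intro y
      have := (tendsto_pi_nhds.1 (hK f) y).eventually
        (lt_mem_nhds (a := transfer L f y - η / 2) (by linarith))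
      exact this.mono fun t ht => ht.le
    have h2 := (Filter.tendsto_add_atTop_nat (m + 1)).eventually h1
    filter_upwards [h2, ih (transfer L f) (half_pos hη)] with t h2 h3 x
    have h4 : expect (chainLaw K x (t + m)) (transfer L f) - η / 2 ≤
        expect (chainLaw K x (t + (m + 1))) f := by
      rw [← add_assoc, chainLaw, expect_bind]
      calc expect (chainLaw K x (t + m)) (transfer L f) - η / 2
          = expect (chainLaw K x (t + m)) (transfer L f - fun _ => η / 2) := by
            rw [map_sub, expect_const]
        _ ≤ _ := expect_mono fun y _ => h2 y
    have h5 := h3 x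
    rw [← Module.End.mul_apply, ← pow_succ] at h5
    linarith

/-- Long-run behaviour of a chain whose kernels converge to a uniformly minorized kernel `L` with
invariant weights `w`: expectations are eventually, uniformly in the starting point, bounded below
by those under the normalized invariant weights. -/
lemma eventually_le_expect_chainLaw {K : ℕ → X → PMF X} {L : X → PMF X} {I : Set X}
    (hI : ∀ t, ∀ x ∈ I, (K t x).support ⊆ I)
    (hK : ∀ f : X → ℝ, Filter.Tendsto (fun t => transfer (K t) f) Filter.atTop
      (nhds (transfer L f)))
    {x₀ : X} (hx₀ : x₀ ∈ I) {ε : ℝ} (hε : 0 < ε) {n : ℕ}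
    (hmin : ∀ f : X → ℝ, (∀ x ∈ I, 0 ≤ f x) → ∀ x ∈ I, ε * f x₀ ≤ (transfer L ^ n) f x)
    {w : X → ℝ} (hw : ∀ x, 0 ≤ w x) (hwI : ∀ x, x ∉ I → w x = 0) (hwpos : 0 < ∑ x, w x)
    (hinv : ∀ f : X → ℝ, ∑ x, w x * transfer L f x = ∑ x, w x * f x)
    (f : X → ℝ) {b : ℝ} (hf : b * ∑ x, w x ≤ ∑ x, w x * f x) {κ : ℝ} (hκ : 0 < κ) :
    ∀ᶠ t in Filter.atTop, ∀ x ∈ I, b - κ ≤ expect (chainLaw K x t) f := by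
  obtain ⟨N, c, hc⟩ := exists_pow_le_of_minorized (U := transfer L ^ n) hx₀ hε
    (transfer_pow_const L n) hmin f (half_pos hκ)
  rw [← pow_mul] at hc
  set m := n * N with hm
  have hinvm : ∀ k : ℕ, ∑ x, w x * (transfer L ^ k) f x = ∑ x, w x * f x := by
    intro k
    induction k with
    | zero => rfl
    | succ k ih => rw [pow_succ', Module.End.mul_apply, hinv, ih]
  -- `transfer L ^ m` preserves the `w`-average of `f` and makes `f` nearly the constant `c` on `I`,
  -- which carries all the weight.
  have hbc : b ≤ c + κ / 2 := by
    refine le_of_mul_le_mul_right (hf.trans ?_) hwpos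
    rw [← hinvm m, Finset.mul_sum]
    refine Finset.sum_le_sum fun x _ => ?_
    by_cases hx : x ∈ I
    · rw [mul_comm]
      exact mul_le_mul_of_nonneg_right (hc x hx).2 (hw x)
    · simp [hwI x hx]
  have hev := eventually_expect_chainLaw_add hK m f (half_pos hκ)
  rw [← Filter.map_add_atTop_eq_nat m, Filter.eventually_map]
  filter_upwards [hev] with t ht x hx
  have h1 : c ≤ expect (chainLaw K x t) ((transfer L ^ m) f) := by
    rw [← expect_const (chainLaw K x t) c]
    exact expect_mono fun y hy => (hc y (support_chainLaw_subset hI hx t hy)).1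
  have h2 := ht x
  linarith

end Markov

/-! ### The CSMA chain -/

section CSMA

variable {V : Type*}

lemma isIndepSet_empty (G : SimpleGraph V) : G.IsIndepSet ((∅ : Finset V) : Set V) := by
  simp

variable [Fintype V]

lemma csmaLaw_eq_chainLaw (G : SimpleGraph V) (q : PMF (Finset V)) (θ : ℕ → V → ℝ)
    (S₀ : Finset V) (t : ℕ) :
    csmaLaw G q θ S₀ t = chainLaw (fun s => csmaStep G q (θ s)) S₀ t := by
  induction t with
  | zero => rfl
  | succ t ih => rw [csmaLaw, chainLaw, ih]

/-! ### One slot of CSMA. -/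

/-- A link of the decision set `D` is free to change its state if no neighbour is in `S`. -/
def IsFree (G : SimpleGraph V) (D S : Finset V) (i : V) : Prop :=
  i ∈ D ∧ ∀ j ∈ S, ¬ G.Adj i j

lemma mem_csmaUpdate_of_isFree {G : SimpleGraph V} {D S : Finset V} {ξ : V → Bool} {i : V}
    (h : IsFree G D S i) : i ∈ csmaUpdate G D ξ S ↔ ξ i = true := by
  classical
  unfold IsFree at h
  unfold csmaUpdate
  rw [Finset.mem_filter, if_pos h]
  simp

lemma mem_csmaUpdate_of_not_isFree {G : SimpleGraph V} {D S : Finset V} {ξ : V → Bool} {i : V}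
    (h : ¬ IsFree G D S i) : i ∈ csmaUpdate G D ξ S ↔ i ∈ S := by
  classical
  unfold IsFree at h
  unfold csmaUpdate
  rw [Finset.mem_filter, if_neg h]
  simp

lemma mem_csmaUpdate_of_notMem {G : SimpleGraph V} {D S : Finset V} {ξ : V → Bool} {i : V}
    (hi : i ∉ D) : i ∈ csmaUpdate G D ξ S ↔ i ∈ S :=
  mem_csmaUpdate_of_not_isFree fun h => hi h.1

/-- When the decision set is independent, the links free to change stay free after the slot. -/
lemma isFree_csmaUpdate_iff {G : SimpleGraph V} {D : Finset V} (hD : G.IsIndepSet (D : Set V))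
    (ξ : V → Bool) (S : Finset V) (i : V) :
    IsFree G D (csmaUpdate G D ξ S) i ↔ IsFree G D S i := by
  refine and_congr_right fun hi => forall_congr' fun j => ?_
  by_cases hj : j ∈ D
  · have : ¬ G.Adj i j := fun h => hD hi hj h.ne h
    simp [this]
  · rw [mem_csmaUpdate_of_notMem hj]

/-- Two adjacent links cannot both be free, since both would lie in `D`. A free link has no
neighbour in `S`, and links that are not free keep their states from `S`. -/
lemma isIndepSet_csmaUpdate {G : SimpleGraph V} {D : Finset V} (hD : G.IsIndepSet (D : Set V))
    (ξ : V → Bool) {S : Finset V} (hS : G.IsIndepSet (S : Set V)) :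
    G.IsIndepSet (csmaUpdate G D ξ S : Set V) := by
  intro i hi j hj hij hadj
  rw [Finset.mem_coe] at hi hj
  by_cases hfi : IsFree G D S i
  · by_cases hfj : IsFree G D S j
    · exact hD hfi.1 hfj.1 hij hadj
    · exact hfi.2 j ((mem_csmaUpdate_of_not_isFree hfj).1 hj) hadj
  · rw [mem_csmaUpdate_of_not_isFree hfi] at hi
    by_cases hfj : IsFree G D S j
    · exact hfj.2 i hi hadj.symm
    · exact hS hi ((mem_csmaUpdate_of_not_isFree hfj).1 hj) hij hadj

/-- An active link of `D` is always free because `S` is independent, so all coins showing `false`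
switch it off. -/
lemma csmaUpdate_false [DecidableEq V] {G : SimpleGraph V} (D : Finset V) {S : Finset V}
    (hS : G.IsIndepSet (S : Set V)) : csmaUpdate G D (fun _ => false) S = S \ D := by
  ext i
  rw [Finset.mem_sdiff]
  by_cases h : IsFree G D S i
  · rw [mem_csmaUpdate_of_isFree h]
    simp [h.1]
  · rw [mem_csmaUpdate_of_not_isFree h]
    exact ⟨fun hi => ⟨hi, fun hD => h ⟨hD, fun j hj hadj => hS hi hj hadj.ne hadj⟩⟩, And.left⟩

lemma support_csmaStep_subset {G : SimpleGraph V} {q : PMF (Finset V)}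
    (hq : ∀ D ∈ q.support, G.IsIndepSet (D : Set V)) (θ : V → ℝ) {S : Finset V}
    (hS : G.IsIndepSet (S : Set V)) :
    (csmaStep G q θ S).support ⊆ {S' | G.IsIndepSet (S' : Set V)} := by
  intro S' hS'
  rw [csmaStep, PMF.mem_support_bind_iff] at hS'
  obtain ⟨D, hD, h⟩ := hS'
  rw [PMF.mem_support_map_iff] at h
  obtain ⟨ξ, -, rfl⟩ := h
  exact isIndepSet_csmaUpdate (hq D hD) ξ hS

lemma toReal_csmaCoins (θ : V → ℝ) (ξ : V → Bool) :
    (csmaCoins θ ξ).toReal =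
      ∏ i, (if ξ i = true then Real.exp (θ i) else 1) / (1 + Real.exp (θ i)) := by
  rw [csmaCoins, MeasureTheory.Measure.toPMF_apply, MeasureTheory.Measure.pi_singleton,
    ENNReal.toReal_prod]
  refine Finset.prod_congr rfl fun i _ => ?_
  rw [← MeasureTheory.measureReal_def]
  cases ξ i
  · rw [ProbabilityTheory.bernoulliMeasure_real_apply_of_notMem_of_mem _
      (MeasurableSet.singleton _) (by simp) (by simp)]
    simp only [accessProb, Bool.false_eq_true, if_false]
    field_simp
    ring
  · rw [ProbabilityTheory.bernoulliMeasure_real_apply_of_mem_of_notMem _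
      (MeasurableSet.singleton _) (by simp) (by simp)]
    simp [accessProb]

lemma toReal_csmaCoins_pos (θ : V → ℝ) (ξ : V → Bool) : 0 < (csmaCoins θ ξ).toReal := by
  rw [toReal_csmaCoins]
  refine Finset.prod_pos fun i _ => ?_
  split_ifs <;> positivity

lemma continuous_toReal_csmaCoins (ξ : V → Bool) :
    Continuous fun θ : V → ℝ => (csmaCoins θ ξ).toReal := by
  simp only [toReal_csmaCoins]
  refine continuous_finsetProd _ fun i _ => Continuous.div ?_ (by fun_prop) fun θ => by positivity
  split_ifs <;> fun_prop

variable [DecidableEq V]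

lemma expect_csmaStep (G : SimpleGraph V) (q : PMF (Finset V)) (θ : V → ℝ) (S : Finset V)
    (f : Finset V → ℝ) :
    expect (csmaStep G q θ S) f =
      expect q fun D => expect (csmaCoins θ) fun ξ => f (csmaUpdate G D ξ S) := by
  simp only [csmaStep, expect_bind, expect_map]

lemma continuous_transfer_csmaStep (G : SimpleGraph V) (q : PMF (Finset V))
    (f : Finset V → ℝ) : Continuous fun θ : V → ℝ => transfer (csmaStep G q θ) f := by
  refine continuous_pi fun S => ?_
  simp only [transfer_apply, expect_csmaStep]
  simp only [expect_apply]
  exact continuous_finsetSum _ fun D _ => continuous_const.mul <|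
    continuous_finsetSum _ fun ξ _ => (continuous_toReal_csmaCoins ξ).mul continuous_const

/-- From every independent set the chain empties the schedule in a fixed number of slots with
probability bounded away from zero. -/
lemma exists_minorization {G : SimpleGraph V} {q : PMF (Finset V)}
    (hq : ∀ D ∈ q.support, G.IsIndepSet (D : Set V)) (hcov : ∀ i, ∃ D ∈ q.support, i ∈ D)
    (θ : V → ℝ) (A : Finset V) :
    ∃ n : ℕ, ∃ ε > 0, ∀ f : Finset V → ℝ, (∀ S : Finset V, G.IsIndepSet (S : Set V) → 0 ≤ f S) →
      ∀ S : Finset V, G.IsIndepSet (S : Set V) → S ⊆ A →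
        ε * f ∅ ≤ (transfer (csmaStep G q θ) ^ n) f S := by
  induction A using Finset.induction_on with
  | empty =>
    refine ⟨0, 1, one_pos, fun f _ S _ hSA => ?_⟩
    rw [Finset.subset_empty.1 hSA]
    simp
  -- One slot with a decision set containing `i` and all coins `false` removes `i` and adds no link,
  -- leaving a subset of `A`; its probability is at least `q D * c`, whatever the schedule.
  | insert i A hi ih =>
    obtain ⟨n, ε, hε, h⟩ := ih
    obtain ⟨D, hDq, hiD⟩ := hcov i
    have hqD : 0 < (q D).toReal := ENNReal.toReal_pos hDq (q.apply_ne_top D)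
    set c := (csmaCoins θ fun _ => false).toReal with hc
    have hcpos : 0 < c := toReal_csmaCoins_pos _ _
    refine ⟨n + 1, (q D).toReal * (c * ε), by positivity, fun f hf S hS hSA => ?_⟩
    rw [pow_succ', Module.End.mul_apply, transfer_apply, expect_csmaStep]
    have hg := transfer_pow_nonneg (K := csmaStep G q θ)
      (I := {S | G.IsIndepSet (S : Set V)}) (fun S hS => support_csmaStep_subset hq θ hS) n hf
    set g := (transfer (csmaStep G q θ) ^ n) f with hgdef
    have h1 := mul_le_expect (p := q)
      (f := fun D => expect (csmaCoins θ) fun ξ => g (csmaUpdate G D ξ S))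
      (fun D hD => expect_nonneg fun ξ _ => hg _ (isIndepSet_csmaUpdate (hq D hD) ξ hS)) D
    refine le_trans ?_ h1
    have h2 := mul_le_expect (p := csmaCoins θ) (f := fun ξ => g (csmaUpdate G D ξ S))
      (fun ξ _ => hg _ (isIndepSet_csmaUpdate (hq D hDq) ξ hS)) (fun _ => false)
    rw [csmaUpdate_false D hS, ← hc] at h2
    have h3 : ε * f ∅ ≤ g (S \ D) := by
      refine h f hf _ (hS.mono (by simp)) fun j hj => ?_
      rw [Finset.mem_sdiff] at hj
      rcases Finset.mem_insert.1 (hSA hj.1) with rfl | hjA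
      · exact (hj.2 hiD).elim
      · exact hjA
    rw [mul_assoc, mul_assoc]
    exact mul_le_mul_of_nonneg_left ((mul_le_mul_of_nonneg_left h3 hcpos.le).trans h2) hqD.le

/-! #### The Gibbs weights -/

open Classical in
/-- The Gibbs weight `exp (θ ⬝ σ)` of an independent set, and `0` for other sets. -/
def gibbsWeight (G : SimpleGraph V) (θ : V → ℝ) (S : Finset V) : ℝ :=
  if G.IsIndepSet (S : Set V) then Real.exp (θ ⬝ᵥ indVec S) else 0

lemma gibbsWeight_nonneg (G : SimpleGraph V) (θ : V → ℝ) (S : Finset V) :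
    0 ≤ gibbsWeight G θ S := by
  rw [gibbsWeight]
  split_ifs <;> positivity

lemma exp_dotProduct_indVec (θ : V → ℝ) (S : Finset V) :
    Real.exp (θ ⬝ᵥ indVec S) = ∏ i, if i ∈ S then Real.exp (θ i) else 1 := by
  rw [dotProduct, Real.exp_sum]
  refine Finset.prod_congr rfl fun i _ => ?_
  by_cases h : i ∈ S <;> simp [indVec, h]

open Classical in
/-- Exchange the states of the free links of `D` with their coins. -/
def csmaSwap (G : SimpleGraph V) (D : Finset V) (z : Finset V × (V → Bool)) :
    Finset V × (V → Bool) :=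
  (csmaUpdate G D z.2 z.1,
    fun i => if IsFree G D z.1 i then decide (i ∈ z.1) else z.2 i)

/-- The swap does not change which links are free, so a second swap exchanges the same entries back.
-/
lemma csmaSwap_involutive {G : SimpleGraph V} {D : Finset V}
    (hD : G.IsIndepSet (D : Set V)) : Function.Involutive (csmaSwap G D) := by
  rintro ⟨S, ξ⟩
  have hfree := isFree_csmaUpdate_iff hD ξ S
  refine Prod.ext ?_ ?_
  · ext i
    by_cases h : IsFree G D S i
    · refine (mem_csmaUpdate_of_isFree ((hfree i).2 h)).trans ?_
      simp [csmaSwap, h]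
    · exact (mem_csmaUpdate_of_not_isFree fun h' => h ((hfree i).1 h')).trans
        (mem_csmaUpdate_of_not_isFree h)
  · funext i
    by_cases h : IsFree G D S i
    · refine (if_pos ((hfree i).2 h)).trans ?_
      rw [Bool.eq_iff_iff, decide_eq_true_eq]
      exact mem_csmaUpdate_of_isFree h
    · exact (if_neg fun h' => h ((hfree i).1 h')).trans (if_neg h)

/-- On independent sets the joint weight is a product over links, in which an active state and a
`true` coin both contribute `exp (θ i)`; exchanging state and coin at a free link only permutes the
factors. This is detailed balance for a fixed decision set. -/
lemma gibbsWeight_mul_csmaCoins_csmaSwap {G : SimpleGraph V} {D : Finset V}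
    (hD : G.IsIndepSet (D : Set V)) (θ : V → ℝ) (z : Finset V × (V → Bool)) :
    gibbsWeight G θ (csmaSwap G D z).1 * (csmaCoins θ (csmaSwap G D z).2).toReal =
      gibbsWeight G θ z.1 * (csmaCoins θ z.2).toReal := by
  obtain ⟨S, ξ⟩ := z
  have hindep : G.IsIndepSet ((csmaSwap G D (S, ξ)).1 : Set V) ↔ G.IsIndepSet (S : Set V) := by
    refine ⟨fun h => ?_, isIndepSet_csmaUpdate hD ξ⟩
    have := isIndepSet_csmaUpdate hD (csmaSwap G D (S, ξ)).2 h
    rwa [show csmaUpdate G D (csmaSwap G D (S, ξ)).2 (csmaSwap G D (S, ξ)).1 = S from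
      congrArg Prod.fst (csmaSwap_involutive hD (S, ξ))] at this
  by_cases hS : G.IsIndepSet (S : Set V)
  · rw [gibbsWeight, if_pos (hindep.2 hS), gibbsWeight, if_pos hS, exp_dotProduct_indVec,
      exp_dotProduct_indVec, toReal_csmaCoins, toReal_csmaCoins,
      ← Finset.prod_mul_distrib, ← Finset.prod_mul_distrib]
    refine Finset.prod_congr rfl fun i _ => ?_
    by_cases h : IsFree G D S i
    · simp only [csmaSwap, mem_csmaUpdate_of_isFree h, if_pos h, decide_eq_true_eq]
      ring
    · simp only [csmaSwap, mem_csmaUpdate_of_not_isFree h, if_neg h]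
  · rw [gibbsWeight, if_neg (mt hindep.1 hS), gibbsWeight, if_neg hS, zero_mul, zero_mul]

/-- The Gibbs weights are invariant under CSMA. -/
lemma sum_gibbsWeight_mul_transfer {G : SimpleGraph V} {q : PMF (Finset V)}
    (hq : ∀ D ∈ q.support, G.IsIndepSet (D : Set V)) (θ : V → ℝ) (f : Finset V → ℝ) :
    ∑ S, gibbsWeight G θ S * transfer (csmaStep G q θ) f S = ∑ S, gibbsWeight G θ S * f S := by
  have hfix : ∀ D ∈ q.support,
      ∑ S, gibbsWeight G θ S * expect (csmaCoins θ) (fun ξ => f (csmaUpdate G D ξ S)) =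
        ∑ S, gibbsWeight G θ S * f S := by
    intro D hD
    -- Updating the schedule is the first coordinate of the swap, so invariance becomes a reindexing
    -- of the sum of `F` over pairs of schedule and coins.
    let F : Finset V × (V → Bool) → ℝ := fun z =>
      gibbsWeight G θ z.1 * (csmaCoins θ z.2).toReal * f z.1
    calc ∑ S, gibbsWeight G θ S * expect (csmaCoins θ) (fun ξ => f (csmaUpdate G D ξ S))
        = ∑ z, F (Function.Involutive.toPerm _ (csmaSwap_involutive (hq D hD)) z) := by
          rw [Fintype.sum_prod_type]
          refine Finset.sum_congr rfl fun S _ => ?_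
          rw [expect_apply, Finset.mul_sum]
          refine Finset.sum_congr rfl fun ξ _ => ?_
          simp only [F, Function.Involutive.coe_toPerm]
          rw [gibbsWeight_mul_csmaCoins_csmaSwap (hq D hD), mul_assoc]
          rfl
      _ = ∑ z, F z := Equiv.sum_comp _ F
      _ = ∑ S, gibbsWeight G θ S * f S := by
          rw [Fintype.sum_prod_type]
          refine Finset.sum_congr rfl fun S _ => ?_
          simp only [F]
          rw [← Finset.sum_mul, ← Finset.mul_sum, sum_toReal_eq_one, mul_one]
  simp only [transfer_apply, expect_csmaStep]
  have hswap : ∑ S, gibbsWeight G θ S *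
        expect q (fun D => expect (csmaCoins θ) fun ξ => f (csmaUpdate G D ξ S)) =
      expect q fun D => ∑ S, gibbsWeight G θ S *
        expect (csmaCoins θ) (fun ξ => f (csmaUpdate G D ξ S)) := by
    simp only [expect_apply q, Finset.mul_sum]
    rw [Finset.sum_comm]
    exact Finset.sum_congr rfl fun D _ => Finset.sum_congr rfl fun S _ => by ring
  rw [hswap]
  refine Eq.trans ?_ (expect_const q (∑ S, gibbsWeight G θ S * f S))
  exact le_antisymm (expect_mono fun D hD => (hfix D hD).le)
    (expect_mono fun D hD => (hfix D hD).ge)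

lemma sum_gibbsWeight_pos (G : SimpleGraph V) (θ : V → ℝ) : 0 < ∑ S, gibbsWeight G θ S :=
  Finset.sum_pos' (fun S _ => gibbsWeight_nonneg G θ S)
    ⟨∅, Finset.mem_univ _, by
      rw [gibbsWeight, if_pos (isIndepSet_empty G)]
      positivity⟩

/-! ### Concentration at low temperature and the limit theorem. -/

lemma exists_isMaxWeightIndepSet (G : SimpleGraph V) (w : V → ℝ) :
    ∃ S, IsMaxWeightIndepSet G w S := by
  classical
  obtain ⟨S, hS, hmax⟩ := Finset.exists_max_image
    (Finset.univ.filter fun S : Finset V => G.IsIndepSet (S : Set V)) (fun S => w ⬝ᵥ indVec S)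
    ⟨∅, Finset.mem_filter.2 ⟨Finset.mem_univ _, isIndepSet_empty G⟩⟩
  exact ⟨S, (Finset.mem_filter.1 hS).2, fun S' hS' =>
    hmax S' (Finset.mem_filter.2 ⟨Finset.mem_univ _, hS'⟩)⟩

/-- At large inverse temperature the Gibbs weights concentrate on the maximum-weight independent
sets. -/
lemma eventually_gibbsWeight_concentrated (G : SimpleGraph V) (θ : V → ℝ) {κ : ℝ} (hκ : 0 < κ) :
    ∀ᶠ α : ℝ in Filter.atTop, (1 - κ) * ∑ S, gibbsWeight G (α • θ) S ≤
      ∑ S, gibbsWeight G (α • θ) S * {S | IsMaxWeightIndepSet G θ S}.indicator 1 S := by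
  obtain ⟨M, hM⟩ := exists_isMaxWeightIndepSet G θ
  set O := {S | IsMaxWeightIndepSet G θ S} with hO
  -- Relative to the weight of a maximizer `M`, each suboptimal independent set decays exponentially
  -- in `α`, at a rate given by its weight gap.
  have hlim : Filter.Tendsto (fun α : ℝ => ∑ S, gibbsWeight G (α • θ) S * Oᶜ.indicator 1 S *
      Real.exp (-(α * (θ ⬝ᵥ indVec M)))) Filter.atTop (nhds 0) := by
    rw [← Finset.sum_const_zero (ι := Finset V) (s := Finset.univ)]
    refine tendsto_finsetSum _ fun S _ => ?_
    by_cases hS : G.IsIndepSet (S : Set V)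
    · by_cases hSO : S ∈ O
      · simp [hSO]
      · have hlt : θ ⬝ᵥ indVec S - θ ⬝ᵥ indVec M < 0 := by
          by_contra! h
          exact hSO ⟨hS, fun S' hS' => (hM.2 S' hS').trans (by linarith)⟩
        have h1 : Filter.Tendsto
            (fun α : ℝ => Real.exp (α * (θ ⬝ᵥ indVec S - θ ⬝ᵥ indVec M)))
            Filter.atTop (nhds 0) :=
          Real.tendsto_exp_atBot.comp (Filter.tendsto_id.atTop_mul_const_of_neg hlt)
        refine h1.congr fun α => ?_
        rw [gibbsWeight, if_pos hS, Set.indicator_of_mem (show S ∈ Oᶜ from hSO), Pi.one_apply,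
          mul_one, ← Real.exp_add, smul_dotProduct, smul_eq_mul]
        ring_nf
    · simp [gibbsWeight, hS]
  filter_upwards [hlim.eventually (gt_mem_nhds hκ)] with α hα
  rw [← Finset.sum_mul, Real.exp_neg, ← div_eq_mul_inv, div_lt_iff₀ (Real.exp_pos _)] at hα
  have hMle : Real.exp (α * (θ ⬝ᵥ indVec M)) ≤ ∑ S, gibbsWeight G (α • θ) S := by
    refine le_trans (le_of_eq ?_) (Finset.single_le_sum (f := gibbsWeight G (α • θ))
      (fun S _ => gibbsWeight_nonneg G _ S) (Finset.mem_univ M))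
    rw [gibbsWeight, if_pos hM.1, smul_dotProduct, smul_eq_mul]
  have hsplit : ∑ S, gibbsWeight G (α • θ) S =
      ∑ S, gibbsWeight G (α • θ) S * O.indicator 1 S +
        ∑ S, gibbsWeight G (α • θ) S * Oᶜ.indicator 1 S := by
    rw [← Finset.sum_add_distrib]
    refine Finset.sum_congr rfl fun S _ => ?_
    by_cases hS : S ∈ O <;> simp [hS]
  have := mul_le_mul_of_nonneg_left hMle hκ.le
  linarith

/-- CSMA with parameters converging to `θ` ends up, with probability close to one, in a
maximum-weight independent set for `θ`, provided that the inverse temperature is large. -/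
lemma eventually_csmaLaw_isMaxWeightIndepSet (G : SimpleGraph V) (θ : V → ℝ) {δ : ℝ}
    (hδ : 0 < δ) :
    ∃ α₀ : ℝ, ∀ α : ℝ, α₀ ≤ α → ∀ q : PMF (Finset V),
      (∀ D ∈ q.support, G.IsIndepSet (D : Set V)) → (∀ i, ∃ D ∈ q.support, i ∈ D) →
      ∀ φ : ℕ → V → ℝ, Filter.Tendsto φ Filter.atTop (nhds θ) →
        ∀ᶠ t in Filter.atTop, ∀ S₀ : Finset V, G.IsIndepSet (S₀ : Set V) →
          1 - δ ≤ ((csmaLaw G q (fun s => α • φ s) S₀ t).toOuterMeasure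
            {S | IsMaxWeightIndepSet G θ S}).toReal := by
  -- The Gibbs weights do not involve `q` or `φ`, so `α₀` is fixed before them. Half of `δ` pays for
  -- concentration and half for mixing.
  obtain ⟨α₀, hα₀⟩ := Filter.eventually_atTop.1
    (eventually_gibbsWeight_concentrated G θ (half_pos hδ))
  refine ⟨α₀, fun α hα q hq hcov φ hφ => ?_⟩
  obtain ⟨n, ε, hε, hmin⟩ := exists_minorization hq hcov (α • θ) Finset.univ
  have h := eventually_le_expect_chainLaw (K := fun s => csmaStep G q (α • φ s))
    (L := csmaStep G q (α • θ)) (I := {S | G.IsIndepSet (S : Set V)})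
    (fun t S hS => support_csmaStep_subset hq _ hS)
    (fun f => ((continuous_transfer_csmaStep G q f).tendsto _).comp (hφ.const_smul α))
    (isIndepSet_empty G) hε (fun f hf S hS => hmin f hf S hS (Finset.subset_univ S))
    (gibbsWeight_nonneg G (α • θ)) (fun S hS => if_neg hS) (sum_gibbsWeight_pos G _)
    (sum_gibbsWeight_mul_transfer hq _) _ (hα₀ α hα) (half_pos hδ)
  filter_upwards [h] with t ht S₀ hS₀
  rw [csmaLaw_eq_chainLaw, toReal_toOuterMeasure_eq_expect]
  have := ht S₀ hS₀
  linarith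

end CSMA

end

end SimplexCSMA

theorem proposition5 {V : Type*} [Fintype V] [DecidableEq V] (G : SimpleGraph V)
    -- the columns of MOV and the rate vector
    (C : Option V → Finset V) (hC : ∀ c, G.IsIndepSet (C c : Set V)) (a : V → ℝ)
    -- an optimal solution of MOV with positive cost
    (x : Option V → ℝ) (γ : ℝ) (hopt : SimplexCSMA.IsMovOptimal C a (x, γ)) (hγ : 0 < γ)
    -- the updated basis matrix: an invertible choice of `n` of the `n + 1` columns, nondegenerate
    (e : V → Option V) (he : Function.Injective e)
    (hB : IsUnit (SimplexCSMA.basisMatrix C e)) (hpos : ∀ k, 0 < x (e k))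
    -- an optimal dual variable of MOV
    (θstar : V → ℝ) (hθstar : SimplexCSMA.IsMovDualOptimal C a θstar)
    (δ : ℝ) (hδ : 0 < δ) :
    ∃ α₀ : ℝ, ∀ α : ℝ, α₀ ≤ α →
      -- the law of the decision sets, and parameters converging to the optimal dual variable
      ∀ q : PMF (Finset V), (∀ D ∈ q.support, G.IsIndepSet (D : Set V)) →
        (∀ i, ∃ D ∈ q.support, i ∈ D) →
      ∀ θ : ℕ → V → ℝ, Filter.Tendsto θ Filter.atTop (nhds θstar) →
      ∃ T : ℕ, ∀ t : ℕ, T ≤ t → ∀ S₀ : Finset V, G.IsIndepSet (S₀ : Set V) →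
        1 - δ ≤ ((SimplexCSMA.csmaLaw G q (fun s => α • θ s) S₀ t).toOuterMeasure
          {S | SimplexCSMA.IsMaxWeightIndepSet G
            ((1 : V → ℝ) ᵥ* (SimplexCSMA.basisMatrix C e)⁻¹) S}).toReal := by
  obtain ⟨hγ1, hθ⟩ := hθstar.eq_smul hopt hγ he hB hpos
  obtain ⟨α₀, h⟩ := SimplexCSMA.eventually_csmaLaw_isMaxWeightIndepSet G θstar hδ
  refine ⟨α₀, fun α hα q hq hcov θ hlim => ?_⟩
  obtain ⟨T, hT⟩ := Filter.eventually_atTop.1 (h α hα q hq hcov θ hlim)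
  refine ⟨T, fun t ht S₀ hS₀ => ?_⟩
  have := hT t ht S₀ hS₀
  -- The positive factor `1 - γ` does not affect the set of maximizers.
  simp only [hθ, SimplexCSMA.isMaxWeightIndepSet_smul_iff (sub_pos.2 hγ1)] at this
  exact this
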